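/- Let $\mathcal L$ be S1S (positions $\mathbb N$, constant $0$, successor $+1$, order $<$) or S2S (positions $\{0,1\}^*$, constant $\varepsilon$, successors $.0$ and $.1$, proper-prefix order $<$), over a finite alphabet $\Sigma$. Formulas are the monadic second-order formulas built from $t=t'$, $t<t'$, $t\in X$, $P_a(t)$ ($a\in\Sigma$), Boolean connectives and quantifiers over positions and sets of positions. An interpretation $w$ is a finite or infinite word (resp. labelled binary tree) over $\Sigma$, and $P_a(t)$ says that position $t$ of $w$ carries $a$. In the full reading (S1S, S2S) set quantifiers range over all sets of positions, in the weak reading (WS1S, WS2S) over the finite ones. A monadic rule $r:\ x\to\psi(x,y),\,y$ is given by a formula $\psi$ whose free variables are among the distinct first-order variables $x,y$. For a reading $s$ and an interpretation $w$, let $R^s_w$ be the binary relation on positions defined by $\psi$. The rule loops in $w$ (under $s$) if there is an infinite sequence $p_0,p_1,\dots$ with $R^s_w(p_n,p_{n+1})$ for all $n$; otherwise it terminates. Its start points are the $p$ such that $R^s_w(p,q)$ for some $q$. A recurrence set is a non-empty set $X$ such that every $p\in X$ has some $q\in X$ with $R^s_w(p,q)$. Let $\varphi_r$ be the sentence $$\exists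 X\,\bigl[\exists x\;x\in X\ \wedge\ \forall x\,\exists y\,(x\in X\Rightarrow(\psi(x,y)\wedge y\in X))\bigr].$$ For a class $K$ of interpretations, a decision procedure for the weak theory of $K$ is a computable function $D$ that, given the code of a sentence, answers whether the sentence is true in all members of $K$ under the weak reading ($K=\{w\}$: truth in $w$; $K$ the class of all interpretations: validity). Then: 1. For each reading $s$ of $\psi$ and each $w$ in which the set of start points of $r$ is finite: every recurrence set is finite; a recurrence set exists if and only if a finite one exists; and $r$ terminates in $w$ if and only if there is no finite recurrence set. 2. If the full and the weak reading of $\psi$ define the same relation in $w$, and the set of start points is finite, then $\varphi_r$ is true in $w$ under the weak reading if and only if it is true in $w$ under the full reading. The two readings of $\psi$ define the same relation whenever $\psi$ contains no set quantifier. 3. $\varphi_r$ is a sentence, and its code is computable from that of $r$, uniformly in $r$. 4. Let $D$ be any decision procedure for the weak theory of $K$. There is a computable function $T$ with $T(r)=D(\neg\varphi_r)$ for all $r$, such that the following holds for every rule $r$ and every reading $s$ of $\psi$ which defines in each $w\in K$ the same relation as the weak reading (no condition if $s$ is the weak reading). If the set of start points of $r$ under $s$ is finite in each $w\in K$, then $T$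 answers "true" on $r$ if and only if $r$ terminates under $s$ in all $w\in K$; $D$ answers "true" on $\varphi_r$ if and only if $r$ loops under $s$ in all $w\in K$; and, if $K=\{w\}$, $D$ answers "false" on $\varphi_r$ if and only if $r$ terminates under $s$ in $w$. -/

import Mathlib

namespace MonadicLoops

/-! ## Rules over an arbitrary domain: operational semantics and recurrence sets -/

/-- The rule given by the binary relation `R` loops: some point starts an infinite computation. -/
def Loops {α : Type} (R : α → α → Prop) : Prop :=
  ∃ x₀ : α, ∃ c : ℕ → α, c 0 = x₀ ∧ ∀ n, R (c n) (c (n + 1))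

/-- The rule given by `R` terminates: no point starts an infinite computation. -/
def Terminates {α : Type} (R : α → α → Prop) : Prop := ¬ Loops R

/-- The points that can start a computation, i.e. from which at least one step is possible. -/
def startPoints {α : Type} (R : α → α → Prop) : Set α := {x | ∃ y, R x y}

/-- `X` is a recurrence set for the rule given by `R`. -/
def IsRecurrenceSet {α : Type} (R : α → α → Prop) (X : Set α) : Prop :=
  (∃ x, x ∈ X) ∧ ∀ x, ∃ y, x ∈ X → R x y ∧ y ∈ X

/-! ## The logics S1S and S2S -/

inductive Logic where
  | S1S
  | S2S

def Logic.numSucc : Logic → ℕ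
  | .S1S => 1
  | .S2S => 2

/-- A set of positions with a constant, `k` successor functions and an order relation. -/
structure SuccStructure (k : ℕ) where
  Pos : Type
  root : Pos
  succ : Fin k → Pos → Pos
  lt : Pos → Pos → Prop

/-- `ℕ` with `0`, `+1` and `<`. -/
def natStructure : SuccStructure 1 where
  Pos := ℕ
  root := 0
  succ := fun _ n => n + 1
  lt := fun n n' => n < n'

/-- `{0,1}*` with the empty word, the two functions appending a letter on the right, and the
proper-prefix relation. -/
def treeStructure : SuccStructure 2 where
  Pos := List (Fin 2)
  root := []
  succ := fun i u => u ++ [i]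
  lt := fun u v => u <+: v ∧ u ≠ v

def Logic.str : (L : Logic) → SuccStructure L.numSucc
  | .S1S => natStructure
  | .S2S => treeStructure

/-- Terms; first-order variables are named by natural numbers. -/
inductive Term (k : ℕ) where
  | root : Term k
  | var (n : ℕ) : Term k
  | succ (i : Fin k) (t : Term k) : Term k

/-- Monadic second-order formulas with `k` successors over the alphabet `Fin m`; the letter
predicate `P_a` is `label a`. First-order and second-order variables are two separate families,
each named by natural numbers; `exF`, `allF` quantify over positions, `exS`, `allS` over sets. -/
inductive Formula (k m : ℕ) where
  | eq (t t' : Term k) : Formula k m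
  | lt (t t' : Term k) : Formula k m
  | mem (t : Term k) (X : ℕ) : Formula k m
  | label (a : Fin m) (t : Term k) : Formula k m
  | neg (φ : Formula k m) : Formula k m
  | and (φ φ' : Formula k m) : Formula k m
  | or (φ φ' : Formula k m) : Formula k m
  | imp (φ φ' : Formula k m) : Formula k m
  | exF (x : ℕ) (φ : Formula k m) : Formula k m
  | allF (x : ℕ) (φ : Formula k m) : Formula k m
  | exS (X : ℕ) (φ : Formula k m) : Formula k m
  | allS (X : ℕ) (φ : Formula k m) : Formula k m

variable {k m : ℕ}

/-- The first-order variables of a term. -/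
def Term.vars : Term k → Set ℕ
  | .root => ∅
  | .var n => {n}
  | .succ _ t => t.vars

/-- The free first-order variables of a formula. -/
def Formula.freeF : Formula k m → Set ℕ
  | .eq t t' => t.vars ∪ t'.vars
  | .lt t t' => t.vars ∪ t'.vars
  | .mem t _ => t.vars
  | .label _ t => t.vars
  | .neg φ => φ.freeF
  | .and φ φ' => φ.freeF ∪ φ'.freeF
  | .or φ φ' => φ.freeF ∪ φ'.freeF
  | .imp φ φ' => φ.freeF ∪ φ'.freeF
  | .exF x φ => φ.freeF \ {x}
  | .allF x φ => φ.freeF \ {x}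
  | .exS _ φ => φ.freeF
  | .allS _ φ => φ.freeF

/-- The free second-order variables of a formula. -/
def Formula.freeS : Formula k m → Set ℕ
  | .eq _ _ => ∅
  | .lt _ _ => ∅
  | .mem _ X => {X}
  | .label _ _ => ∅
  | .neg φ => φ.freeS
  | .and φ φ' => φ.freeS ∪ φ'.freeS
  | .or φ φ' => φ.freeS ∪ φ'.freeS
  | .imp φ φ' => φ.freeS ∪ φ'.freeS
  | .exF _ φ => φ.freeS
  | .allF _ φ => φ.freeS
  | .exS X φ => φ.freeS \ {X}
  | .allS X φ => φ.freeS \ {X}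

def Formula.IsSentence (φ : Formula k m) : Prop := φ.freeF = ∅ ∧ φ.freeS = ∅

/-- No quantifier over sets occurs in the formula. -/
def Formula.NoSetQuantifier : Formula k m → Prop
  | .eq _ _ => True
  | .lt _ _ => True
  | .mem _ _ => True
  | .label _ _ => True
  | .neg φ => φ.NoSetQuantifier
  | .and φ φ' => φ.NoSetQuantifier ∧ φ'.NoSetQuantifier
  | .or φ φ' => φ.NoSetQuantifier ∧ φ'.NoSetQuantifier
  | .imp φ φ' => φ.NoSetQuantifier ∧ φ'.NoSetQuantifier
  | .exF _ φ => φ.NoSetQuantifier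
  | .allF _ φ => φ.NoSetQuantifier
  | .exS _ _ => False
  | .allS _ _ => False

/-- Interpretations: finite or infinite words (for S1S) or labelled binary trees (for S2S) over the
alphabet `Fin m`. The labelled positions are closed under predecessors; positions outside the word
or tree carry no letter. -/
structure Interp (L : Logic) (m : ℕ) where
  letter : L.str.Pos → Option (Fin m)
  closed : ∀ p q, L.str.lt p q → letter p = none → letter q = none

/-- The full reading (S1S, S2S) lets set quantifiers range over all sets of positions, the weak
reading (WS1S, WS2S) over the finite ones only. -/
inductive Reading where
  | full
  | weak

def Reading.Admits {α : Type} : Reading → Set α → Prop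
  | .full, _ => True
  | .weak, X => X.Finite

variable {L : Logic}

def Term.val (S : SuccStructure k) (v : ℕ → S.Pos) : Term k → S.Pos
  | .root => S.root
  | .var n => v n
  | .succ i t => S.succ i (t.val S v)

/-- Satisfaction under an assignment `v` of positions and `V` of sets to the variables. -/
def Formula.Holds (s : Reading) (w : Interp L m) :
    Formula L.numSucc m → (ℕ → L.str.Pos) → (ℕ → Set L.str.Pos) → Prop
  | .eq t t', v, _ => t.val L.str v = t'.val L.str v
  | .lt t t', v, _ => L.str.lt (t.val L.str v) (t'.val L.str v)
  | .mem t X, v, V => t.val L.str v ∈ V X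
  | .label a t, v, _ => w.letter (t.val L.str v) = some a
  | .neg φ, v, V => ¬ φ.Holds s w v V
  | .and φ φ', v, V => φ.Holds s w v V ∧ φ'.Holds s w v V
  | .or φ φ', v, V => φ.Holds s w v V ∨ φ'.Holds s w v V
  | .imp φ φ', v, V => φ.Holds s w v V → φ'.Holds s w v V
  | .exF x φ, v, V => ∃ p, φ.Holds s w (Function.update v x p) V
  | .allF x φ, v, V => ∀ p, φ.Holds s w (Function.update v x p) V
  | .exS X φ, v, V => ∃ A, s.Admits A ∧ φ.Holds s w v (Function.update V X A)
  | .allS X φ, v, V => ∀ A, s.Admits A → φ.Holds s w v (Function.update V X A)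

/-- Truth of a sentence in an interpretation; for a sentence the assignments do not matter. -/
def Formula.IsTrue (s : Reading) (w : Interp L m) (φ : Formula L.numSucc m) : Prop :=
  φ.Holds s w (fun _ => L.str.root) (fun _ => ∅)

/-! ## Formulas as inputs of algorithms -/

/-- Terms written in Polish notation over the tokens `0, 1, 2, …`. -/
def Term.code : Term k → List ℕ
  | .root => [0]
  | .var n => [1, n]
  | .succ i t => 2 :: (i : ℕ) :: t.code

/-- Formulas written in Polish notation over the tokens `0, 1, 2, …`. -/
def Formula.code : Formula k m → List ℕ
  | .eq t t' => 0 :: (t.code ++ t'.code)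
  | .lt t t' => 1 :: (t.code ++ t'.code)
  | .mem t X => 2 :: X :: t.code
  | .label a t => 3 :: (a : ℕ) :: t.code
  | .neg φ => 4 :: φ.code
  | .and φ φ' => 5 :: (φ.code ++ φ'.code)
  | .or φ φ' => 6 :: (φ.code ++ φ'.code)
  | .imp φ φ' => 7 :: (φ.code ++ φ'.code)
  | .exF x φ => 8 :: x :: φ.code
  | .allF x φ => 9 :: x :: φ.code
  | .exS X φ => 10 :: X :: φ.code
  | .allS X φ => 11 :: X :: φ.code

theorem Term.code_append_inj (t : Term k) : ∀ (t' : Term k) (l l' : List ℕ),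
    t.code ++ l = t'.code ++ l' → t = t' ∧ l = l' := by
  induction t with
  | root => intro t' l l' h; cases t' <;> simp_all [Term.code]
  | var n => intro t' l l' h; cases t' <;> simp_all [Term.code]
  | succ i t ih =>
    intro t' l l' h
    cases t' with
    | succ j u =>
      simp only [Term.code, List.cons_append, List.cons.injEq, true_and] at h
      obtain ⟨h1, h2⟩ := h
      obtain ⟨rfl, rfl⟩ := ih _ _ _ h2
      exact ⟨by rw [Fin.ext h1], rfl⟩
    | _ => simp_all [Term.code]

theorem Formula.code_append_inj (φ : Formula k m) : ∀ (φ' : Formula k m) (l l' : List ℕ),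
    φ.code ++ l = φ'.code ++ l' → φ = φ' ∧ l = l' := by
  induction φ with
  | eq t u | lt t u =>
    intro φ' l l' h
    cases φ' <;> simp only [Formula.code, List.cons_append, List.append_assoc, List.cons.injEq,
      true_and, false_and, one_ne_zero, zero_ne_one, OfNat.zero_ne_ofNat, OfNat.one_ne_ofNat] at h
    obtain ⟨rfl, h2⟩ := Term.code_append_inj _ _ _ _ h
    obtain ⟨rfl, rfl⟩ := Term.code_append_inj _ _ _ _ h2
    exact ⟨rfl, rfl⟩
  | mem t X | label X t =>
    intro φ' l l' h
    cases φ' <;> simp only [Formula.code, List.cons_append, List.cons.injEq,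
      true_and, false_and, OfNat.ofNat_ne_zero, OfNat.ofNat_ne_one, Nat.reduceEqDiff] at h
    obtain ⟨h1, h⟩ := h
    obtain ⟨rfl, rfl⟩ := Term.code_append_inj _ _ _ _ h
    exact ⟨by simp [h1, Fin.ext_iff], rfl⟩
  | neg φ ih =>
    intro φ' l l' h
    cases φ' <;> simp only [Formula.code, List.cons_append, List.cons.injEq,
      true_and, false_and, OfNat.ofNat_ne_zero, OfNat.ofNat_ne_one, Nat.reduceEqDiff] at h
    obtain ⟨rfl, rfl⟩ := ih _ _ _ h
    exact ⟨rfl, rfl⟩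
  | and φ ψ ih ih' | or φ ψ ih ih' | imp φ ψ ih ih' =>
    intro φ' l l' h
    cases φ' <;> simp only [Formula.code, List.cons_append, List.append_assoc, List.cons.injEq,
      true_and, false_and, OfNat.ofNat_ne_zero, OfNat.ofNat_ne_one, Nat.reduceEqDiff] at h
    obtain ⟨rfl, h2⟩ := ih _ _ _ h
    obtain ⟨rfl, rfl⟩ := ih' _ _ _ h2
    exact ⟨rfl, rfl⟩
  | exF x φ ih | allF x φ ih | exS x φ ih | allS x φ ih =>
    intro φ' l l' h
    cases φ' <;> simp only [Formula.code, List.cons_append, List.cons.injEq,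
      true_and, false_and, OfNat.ofNat_ne_zero, OfNat.ofNat_ne_one, Nat.reduceEqDiff] at h
    obtain ⟨rfl, h⟩ := h
    obtain ⟨rfl, rfl⟩ := ih _ _ _ h
    exact ⟨rfl, rfl⟩

/-- A formula can be recovered from its code. -/
theorem Formula.code_injective : Function.Injective (Formula.code (k := k) (m := m)) := by
  intro φ φ' h
  exact (Formula.code_append_inj φ φ' [] [] (by rw [h])).1

/-- `D` is a decision procedure for the weak theory (WS1S or WS2S, according to `L`) of the class `K`
of interpretations: a computable function that, on every sentence, says whether the sentence is true
in all members of `K` under the weak reading. For `K = {w}` this is truth in the single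
interpretation `w`, for `K = Set.univ` it is validity. -/
def IsWeakDecisionProcedure (K : Set (Interp L m)) (D : List ℕ → Bool) : Prop :=
  Computable D ∧ ∀ φ : Formula L.numSucc m, φ.IsSentence →
    (D φ.code = true ↔ ∀ w ∈ K, φ.IsTrue .weak w)

/-! ## Monadic rules -/

/-- A monadic S1S (S2S) rule `x → ψ(x, y), y`. -/
structure Rule (L : Logic) (m : ℕ) where
  x : ℕ
  y : ℕ
  x_ne_y : x ≠ y
  ψ : Formula L.numSucc m
  freeF_subset : ψ.freeF ⊆ {x, y}
  freeS_eq : ψ.freeS = ∅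

/-- The rule as an input of an algorithm. -/
def Rule.code (r : Rule L m) : List ℕ := r.x :: r.y :: r.ψ.code

/-- The binary relation on positions defined by `ψ` in `w`, when the set quantifiers inside `ψ` are
read according to `s`. -/
def Rule.rel (r : Rule L m) (s : Reading) (w : Interp L m) (p q : L.str.Pos) : Prop :=
  r.ψ.Holds s w (Function.update (Function.update (fun _ => L.str.root) r.x p) r.y q) (fun _ => ∅)

/-- The sentence `φ_r`, that is
`∃ X, (∃ x, x ∈ X) ∧ ∀ x, ∃ y, (x ∈ X → ψ(x, y) ∧ y ∈ X)`. The name chosen for `X` does not matter,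
since `ψ` has no free second-order variable. -/
def Rule.phi (r : Rule L m) : Formula L.numSucc m :=
  .exS 0 (.and
    (.exF r.x (.mem (.var r.x) 0))
    (.allF r.x (.exF r.y (.imp (.mem (.var r.x) 0) (.and r.ψ (.mem (.var r.y) 0))))))

end MonadicLoops

open MonadicLoops

namespace MonadicLoops

/-! ## Recurrence sets of a binary relation -/

section Recurrence

variable {α : Type} {R : α → α → Prop}

/-! Looping is the same as having a recurrence set: the range of an infinite computation is one, and
choosing successors inside one yields an infinite computation (`loops_iff_exists_isRecurrenceSet`).
Every element of a recurrence set has a step, so it is a start point. With finitely many start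
points, restricting the set quantifier of φ_r to finite sets therefore loses nothing. Under either
reading, φ_r says that an admissible recurrence set exists (`Rule.phi_isTrue_iff`), so its weak
truth is looping. A decision procedure for the weak theory is then applied to φ_r or its negation,
whose codes arise from that of the rule by rearranging tokens (`phiCode`). -/

theorem IsRecurrenceSet.subset_startPoints {X : Set α} (h : IsRecurrenceSet R X) :
    X ⊆ startPoints R := fun x hx =>
  let ⟨y, hy⟩ := h.2 x
  ⟨y, (hy hx).1⟩

theorem IsRecurrenceSet.finite {X : Set α} (h : IsRecurrenceSet R X)
    (hR : (startPoints R).Finite) : X.Finite :=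
  hR.subset h.subset_startPoints

theorem loops_iff_exists_isRecurrenceSet : Loops R ↔ ∃ X, IsRecurrenceSet R X := by
  constructor
  · rintro ⟨x₀, c, -, hc⟩
    refine ⟨Set.range c, ⟨c 0, 0, rfl⟩, fun x => ?_⟩
    by_cases hx : x ∈ Set.range c
    · obtain ⟨n, rfl⟩ := hx
      exact ⟨c (n + 1), fun _ => ⟨hc n, n + 1, rfl⟩⟩
    -- Off the range the implication is vacuous, so any witness will do.
    · exact ⟨x, fun h => absurd h hx⟩
  · rintro ⟨X, ⟨x₀, hx₀⟩, h⟩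
    -- As `∃ y` stands outside the implication, choice gives a total function `g`, which can be
    -- iterated from `x₀`.
    choose g hg using h
    have hmem : ∀ n, g^[n] x₀ ∈ X := by
      intro n
      induction n with
      | zero => exact hx₀
      | succ n ih =>
        rw [Function.iterate_succ_apply']
        exact (hg _ ih).2
    refine ⟨x₀, fun n => g^[n] x₀, rfl, fun n => ?_⟩
    simp only [Function.iterate_succ_apply']
    exact (hg _ (hmem n)).1

theorem exists_finite_isRecurrenceSet_iff (hR : (startPoints R).Finite) :
    (∃ X, X.Finite ∧ IsRecurrenceSet R X) ↔ ∃ X, IsRecurrenceSet R X :=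
  ⟨fun ⟨X, _, h⟩ => ⟨X, h⟩, fun ⟨X, h⟩ => ⟨X, h.finite hR, h⟩⟩

theorem loops_iff_exists_finite_isRecurrenceSet (hR : (startPoints R).Finite) :
    Loops R ↔ ∃ X, X.Finite ∧ IsRecurrenceSet R X := by
  rw [exists_finite_isRecurrenceSet_iff hR, loops_iff_exists_isRecurrenceSet]

end Recurrence

/-! ## Semantics -/

section Semantics

variable {L : Logic} {m : ℕ}

/-- Needed because φ_r evaluates ψ with its own set variable assigned, whereas `Rule.rel` assigns
the empty set everywhere. -/
theorem Formula.holds_congr_sets (s : Reading) (w : Interp L m) (φ : Formula L.numSucc m) :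
    ∀ (v : ℕ → L.str.Pos) (V V' : ℕ → Set L.str.Pos), (∀ X ∈ φ.freeS, V X = V' X) →
      (φ.Holds s w v V ↔ φ.Holds s w v V') := by
  induction φ with
  | eq | lt | label => intros; exact Iff.rfl
  | mem t X =>
    intro v V V' h
    simp only [Formula.Holds, h X rfl]
  | neg φ ih =>
    intro v V V' h
    exact not_congr (ih v V V' h)
  | and φ ψ ih ih' =>
    intro v V V' h
    exact and_congr (ih v V V' fun X hX => h X (Or.inl hX))
      (ih' v V V' fun X hX => h X (Or.inr hX))
  | or φ ψ ih ih' =>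
    intro v V V' h
    exact or_congr (ih v V V' fun X hX => h X (Or.inl hX))
      (ih' v V V' fun X hX => h X (Or.inr hX))
  | imp φ ψ ih ih' =>
    intro v V V' h
    exact imp_congr (ih v V V' fun X hX => h X (Or.inl hX))
      (ih' v V V' fun X hX => h X (Or.inr hX))
  | exF x φ ih =>
    intro v V V' h
    exact exists_congr fun p => ih _ V V' h
  | allF x φ ih =>
    intro v V V' h
    exact forall_congr' fun p => ih _ V V' h
  | exS X φ ih | allS X φ ih =>
    intro v V V' h
    have key : ∀ A, φ.Holds s w v (Function.update V X A) ↔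
        φ.Holds s w v (Function.update V' X A) := by
      refine fun A => ih _ _ _ fun Y hY => ?_
      by_cases hYX : Y = X
      · subst hYX; simp
      · simpa [Function.update_of_ne hYX] using h Y ⟨hY, hYX⟩
    simp only [Formula.Holds, key]

theorem Formula.holds_iff_of_noSetQuantifier (s s' : Reading) (w : Interp L m)
    (φ : Formula L.numSucc m) (hφ : φ.NoSetQuantifier) :
    ∀ (v : ℕ → L.str.Pos) (V : ℕ → Set L.str.Pos), φ.Holds s w v V ↔ φ.Holds s' w v V := by
  induction φ with
  | eq | lt | mem | label => intros; exact Iff.rfl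
  | neg φ ih => exact fun v V => not_congr (ih hφ v V)
  | and φ ψ ih ih' => exact fun v V => and_congr (ih hφ.1 v V) (ih' hφ.2 v V)
  | or φ ψ ih ih' => exact fun v V => or_congr (ih hφ.1 v V) (ih' hφ.2 v V)
  | imp φ ψ ih ih' => exact fun v V => imp_congr (ih hφ.1 v V) (ih' hφ.2 v V)
  | exF x φ ih => exact fun v V => exists_congr fun p => ih hφ _ V
  | allF x φ ih => exact fun v V => forall_congr' fun p => ih hφ _ V
  | exS | allS => exact hφ.elim

theorem Rule.phi_isTrue_iff (r : Rule L m) (s : Reading) (w : Interp L m) :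
    r.phi.IsTrue s w ↔ ∃ X, s.Admits X ∧ IsRecurrenceSet (r.rel s w) X := by
  have key : ∀ (A : Set L.str.Pos) (v : ℕ → L.str.Pos),
      r.ψ.Holds s w v (Function.update (fun _ => ∅) 0 A) ↔ r.ψ.Holds s w v (fun _ => ∅) :=
    fun A v => Formula.holds_congr_sets s w r.ψ v _ _ (by simp [r.freeS_eq])
  -- Distinctness of the two variables ensures that assigning `r.y` does not overwrite the value of
  -- `r.x`.
  simp only [Formula.IsTrue, Rule.phi, Formula.Holds, Term.val, key, Function.update_self,
    Function.update_of_ne r.x_ne_y, IsRecurrenceSet, Rule.rel]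

theorem Rule.phi_isTrue_weak_iff_loops (r : Rule L m) (w : Interp L m)
    (h : (startPoints (r.rel .weak w)).Finite) : r.phi.IsTrue .weak w ↔ Loops (r.rel .weak w) := by
  rw [r.phi_isTrue_iff, loops_iff_exists_finite_isRecurrenceSet h]
  rfl

/-- Every set is admitted here, so no finiteness of start points is required. -/
theorem Rule.phi_isTrue_full_iff_loops (r : Rule L m) (w : Interp L m) :
    r.phi.IsTrue .full w ↔ Loops (r.rel .full w) := by
  rw [r.phi_isTrue_iff, loops_iff_exists_isRecurrenceSet]
  simp [Reading.Admits]

theorem Rule.phi_isSentence (r : Rule L m) : r.phi.IsSentence := by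
  constructor
  · ext n
    have := @r.freeF_subset n
    simp only [Rule.phi, Formula.freeF, Term.vars, Set.mem_union, Set.mem_sdiff,
      Set.mem_singleton_iff, Set.mem_insert_iff, Set.mem_empty_iff_false] at this ⊢
    tauto
  · simp [Rule.phi, Formula.freeS, r.freeS_eq]

end Semantics

/-! ## Computability of the sentence of a rule -/

section Code

/-- The code of the sentence `φ_r` as a function of the code of the rule `r`. -/
def phiCode (l : List ℕ) : List ℕ :=
  [10, 0, 5, 8] ++ (l.headI :: [2, 0, 1] ++ (l.headI :: [9] ++ (l.headI :: [8] ++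
    (l.tail.headI :: [7, 2, 0, 1] ++ (l.headI :: [5] ++
      (l.tail.tail ++ ([2, 0, 1] ++ [l.tail.headI])))))))

theorem primrec_phiCode : Primrec phiCode := by
  have hx : Primrec fun l : List ℕ => l.headI := Primrec.list_headI
  have hy : Primrec fun l : List ℕ => l.tail.headI := Primrec.list_headI.comp Primrec.list_tail
  have hψ : Primrec fun l : List ℕ => l.tail.tail := Primrec.list_tail.comp Primrec.list_tail
  have app {f g : List ℕ → List ℕ} (hf : Primrec f) (hg : Primrec g) :
      Primrec fun l => f l ++ g l := Primrec.list_append.comp hf hg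
  have cons {f : List ℕ → ℕ} {g : List ℕ → List ℕ} (hf : Primrec f) (hg : Primrec g) :
      Primrec fun l => f l :: g l := Primrec.list_cons.comp hf hg
  have c (l' : List ℕ) : Primrec fun _ : List ℕ => l' := Primrec.const l'
  exact app (c _) (app (cons hx (c _)) (app (cons hx (c _)) (app (cons hx (c _))
    (app (cons hy (c _)) (app (cons hx (c _)) (app hψ (app (c _) (cons hy (c _)))))))))

theorem phiCode_code {L : Logic} {m : ℕ} (r : Rule L m) : phiCode r.code = r.phi.code := by
  simp [phiCode, Rule.code, Rule.phi, Formula.code, Term.code]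

end Code

/-! ## Deciding termination -/

section Decision

variable {L : Logic} {m : ℕ} {K : Set (Interp L m)} {D : List ℕ → Bool}

theorem IsWeakDecisionProcedure.phi_iff (hD : IsWeakDecisionProcedure K D) (r : Rule L m)
    (h : ∀ w ∈ K, (startPoints (r.rel .weak w)).Finite) :
    D r.phi.code = true ↔ ∀ w ∈ K, Loops (r.rel .weak w) := by
  rw [hD.2 _ r.phi_isSentence]
  exact forall₂_congr fun w hw => r.phi_isTrue_weak_iff_loops w (h w hw)

theorem IsWeakDecisionProcedure.neg_phi_iff (hD : IsWeakDecisionProcedure K D) (r : Rule L m)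
    (h : ∀ w ∈ K, (startPoints (r.rel .weak w)).Finite) :
    D r.phi.neg.code = true ↔ ∀ w ∈ K, Terminates (r.rel .weak w) := by
  -- Negation leaves the free variables definitionally unchanged.
  rw [hD.2 r.phi.neg r.phi_isSentence]
  exact forall₂_congr fun w hw => not_congr (r.phi_isTrue_weak_iff_loops w (h w hw))

end Decision

end MonadicLoops

theorem mainTheorem3 (L : Logic) (m : ℕ) :
    -- with a finite set of start points, only finite recurrence sets matter, for both readings of ψ
    (∀ (r : Rule L m) (s : Reading) (w : Interp L m), (startPoints (r.rel s w)).Finite →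
      (∀ X, IsRecurrenceSet (r.rel s w) X → X.Finite) ∧
      ((∃ X, X.Finite ∧ IsRecurrenceSet (r.rel s w) X) ↔ ∃ X, IsRecurrenceSet (r.rel s w) X) ∧
      (Terminates (r.rel s w) ↔ ¬ ∃ X, X.Finite ∧ IsRecurrenceSet (r.rel s w) X)) ∧
    -- the weak and the full reading of the sentence φ_r coincide
    (∀ (r : Rule L m) (w : Interp L m),
      (∀ p q, r.rel .full w p q ↔ r.rel .weak w p q) →
      (startPoints (r.rel .full w)).Finite →
      (r.phi.IsTrue .weak w ↔ r.phi.IsTrue .full w)) ∧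
    -- the two readings of ψ agree when ψ has no set quantifier
    (∀ (r : Rule L m) (w : Interp L m), r.ψ.NoSetQuantifier →
      ∀ p q, r.rel .full w p q ↔ r.rel .weak w p q) ∧
    -- φ_r is a sentence, computable from r
    (∀ r : Rule L m, r.phi.IsSentence) ∧
    (∃ f : List ℕ → List ℕ, Computable f ∧ ∀ r : Rule L m, f r.code = r.phi.code) ∧
    -- every decision procedure for the weak logic decides termination
    (∀ (K : Set (Interp L m)) (D : List ℕ → Bool), IsWeakDecisionProcedure K D →
      ∃ T : List ℕ → Bool, Computable T ∧ (∀ r : Rule L m, T r.code = D r.phi.neg.code) ∧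
        ∀ (r : Rule L m) (s : Reading),
          (∀ w ∈ K, ∀ p q, r.rel s w p q ↔ r.rel .weak w p q) →
          (∀ w ∈ K, (startPoints (r.rel s w)).Finite) →
          (T r.code = true ↔ ∀ w ∈ K, Terminates (r.rel s w)) ∧
          (D r.phi.code = true ↔ ∀ w ∈ K, Loops (r.rel s w)) ∧
          (∀ w, K = {w} → (D r.phi.code = false ↔ Terminates (r.rel s w)))) := by
  refine ⟨fun r s w h => ⟨fun X hX => hX.finite h, exists_finite_isRecurrenceSet_iff h,
    not_congr (loops_iff_exists_finite_isRecurrenceSet h)⟩, fun r w hrel h => ?_,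
    fun r w hψ p q => Formula.holds_iff_of_noSetQuantifier _ _ w r.ψ hψ _ _,
    Rule.phi_isSentence, ⟨phiCode, primrec_phiCode.to_comp, phiCode_code⟩, fun K D hD => ?_⟩
  · have e : r.rel .full w = r.rel .weak w := funext₂ fun p q => propext (hrel p q)
    rw [r.phi_isTrue_full_iff_loops, r.phi_isTrue_weak_iff_loops w (e ▸ h), e]
  -- The token 4 codes negation.
  · have hT (r : Rule L m) : (fun l => D (4 :: phiCode l)) r.code = D r.phi.neg.code := by
      simp only [phiCode_code, Formula.code]
    refine ⟨fun l => D (4 :: phiCode l),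
      hD.1.comp (Primrec.list_cons.comp (Primrec.const 4) primrec_phiCode).to_comp,
      hT, fun r s hrel h => ?_⟩
    have e : ∀ w ∈ K, r.rel s w = r.rel .weak w := fun w hw =>
      funext₂ fun p q => propext (hrel w hw p q)
    have h' : ∀ w ∈ K, (startPoints (r.rel .weak w)).Finite := fun w hw => e w hw ▸ h w hw
    have loops : D r.phi.code = true ↔ ∀ w ∈ K, Loops (r.rel s w) :=
      (hD.phi_iff r h').trans (forall₂_congr fun w hw => by rw [e w hw])
    refine ⟨?_, loops, ?_⟩
    · rw [hT, hD.neg_phi_iff r h']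
      exact forall₂_congr fun w hw => by rw [e w hw]
    -- For a singleton class, failure to loop in all members is termination in the only one; in
    -- general it gives termination in some member only.
    · rintro w rfl
      rw [← Bool.not_eq_true, loops, Terminates]
      simp
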